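/- **Corollary (support recovery by the STG estimator for sub-Gaussian designs).** For every sample size $N\ge 1$ let $D=D_N$ and $K=K_N$ be integers, let $\beta^*=\beta^*_N\in\mathbb R^{D}$ have exactly $K$ non-zero entries, all of them of magnitude larger than a constant $\eta>0$ that does not depend on $N$, and let $\lambda_N\ge 0$. Fix $\sigma\ge 0$ and $\tau>0$. Let $x_1,\dots,x_N$ be independent random vectors in $\mathbb R^{D}$ with common mean vector $\mu=\mu_N$ and covariance matrix $\Sigma=\Sigma_N$ that are sub-Gaussian: for a constant $L>0$ that does not depend on $N$, $\mathbb P[|x_i^{\mathsf T}u|>t]\le 2e^{-t^2/L^2}$ for all $i$, all $u\in\mathbb R^D$ with $\|u\|_2=1$ and all $t\ge 0$. Suppose that the smallest eigenvalue of $\Sigma+\mu\mu^{\mathsf T}$ is bounded below by a constant $\rho>0$ for all large $N$ (when $D,\mu,\Sigma$ do not depend on $N$, this says that it is positive). Let $X=[x_1,\dots,x_N]^{\mathsf T}$ and $y=X\beta^*+\epsilon$, where $\epsilon\sim\mathcal N(0,\sigma^2I_N)$ is independent of $X$. For $m\in\mathbb R^D$ and $\delta\sim\mathcal N(0,\tau^2I_D)$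 let $z(m)$ be the vector of gates $z_d(m_d)=\max(0,\min(1,m_d+\delta_d))$, and, with $\Phi$ the standard normal distribution function and $\odot$ the coordinatewise product, let $$\mathsf{Risk}(\theta,m)=\frac1N\,\mathbb E_{z}\|y-X(\theta\odot z(m))\|_2^2+\lambda_N\sum_{d=1}^D\Phi\Big(\frac{m_d}{\tau}\Big),\qquad \theta,m\in\mathbb R^D .$$ Let $r_N\ge 0$ with $r_N\to 0$, and let $(\hat\theta,\hat m)$ be a random pair which almost surely minimizes the risk up to $r_N$, that is, $\mathsf{Risk}(\hat\theta,\hat m)\le \mathsf{Risk}(\theta,m)+r_N$ for all $\theta,m\in\mathbb R^D$ (for $r_N=0$: any exact minimizer). The STG estimator is $\hat\beta=\hat\theta\odot z(\hat m)$, where the gate noise $\delta$ used in $z(\hat m)$ is independent of $(X,\epsilon,\hat\theta,\hat m)$. If $D/N\to0$ and $K\lambda_N\to0$ as $N\to\infty$, then the STG estimator recovers the support of $\beta^*$ with probability tending to $1$: the probability that, for every way of breaking ties, the set of indices of the $K$ entries of $\hat\beta$ of largest magnitude equals $\{d:\beta^*_d\neq0\}$ tends to $1$. -/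

import Mathlib

open MeasureTheory ProbabilityTheory Filter Topology
open scoped NNReal

noncomputable section

namespace STG

/-- The stochastic gate with parameter `m` and noise value `d`:
`max (0, min (1, m + d))`. -/
def gate (m d : ℝ) : ℝ := max 0 (min 1 (m + d))

/-- The vector of gates `z(m)`, evaluated at the noise vector `d`. -/
def gates {D : ℕ} (m d : Fin D → ℝ) : Fin D → ℝ := fun j => gate (m j) (d j)

/-- The law `N(0, s² I_n)` on `ℝⁿ`: independent coordinates with law `N(0, s²)`. -/
def gaussianVec (n : ℕ) (s : ℝ≥0) : Measure (Fin n → ℝ) :=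
  Measure.pi fun _ => gaussianReal 0 (s ^ 2)

/-- The standard normal cumulative distribution function `Φ`. -/
def stdNormalCdf (t : ℝ) : ℝ := cdf (gaussianReal 0 1) t

/-- The STG risk
`E_z ‖y - X (θ ⊙ z(m))‖₂² / N + lam * ∑ d, Φ (m d / τ)`. -/
def risk {N D : ℕ} (X : Matrix (Fin N) (Fin D) ℝ) (y : Fin N → ℝ) (lam : ℝ) (τ : ℝ≥0)
    (θ m : Fin D → ℝ) : ℝ :=
  (∫ d, ‖WithLp.toLp 2 (y - X.mulVec (θ * gates m d))‖ ^ 2 ∂(gaussianVec D τ)) / N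
    + lam * ∑ j, stdNormalCdf (m j / τ)

/-- `(θ, m)` minimizes the STG risk over `ℝ^D × ℝ^D` up to the additive error `r`.
For `r = 0` it is an exact minimizer. -/
def IsNearMinimizer {N D : ℕ} (X : Matrix (Fin N) (Fin D) ℝ) (y : Fin N → ℝ) (lam : ℝ)
    (τ : ℝ≥0) (r : ℝ) (θ m : Fin D → ℝ) : Prop :=
  ∀ θ' m' : Fin D → ℝ, risk X y lam τ θ m ≤ risk X y lam τ θ' m' + r

/-- A random vector is sub-Gaussian with constant `L` if all its one-dimensional marginals
along Euclidean unit vectors have tails at most `2 exp (-t² / L²)`. -/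
def IsSubGaussianVec {Ω : Type*} [MeasurableSpace Ω] (P : Measure Ω) {D : ℕ} (L : ℝ)
    (x : Ω → Fin D → ℝ) : Prop :=
  ∀ u : EuclideanSpace ℝ (Fin D), ‖u‖ = 1 → ∀ t : ℝ, 0 ≤ t →
    P.real {ω | t < |∑ j, x ω j * u j|} ≤ 2 * Real.exp (-t ^ 2 / L ^ 2)

/-- The smallest eigenvalue of a real symmetric matrix of positive size. -/
def rhoMin {D : ℕ} (A : Matrix (Fin D) (Fin D) ℝ) : ℝ :=
  sInf {r : ℝ | Module.End.HasEigenvalue (Matrix.toLin' A) r}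

/-- The set of indices of the non-zero entries. -/
def supp {D : ℕ} (b : Fin D → ℝ) : Finset (Fin D) := Finset.univ.filter fun j => b j ≠ 0

/-- `T` is a set of indices of `K` entries of `b` of largest magnitude (for some way of
breaking ties). -/
def IsTopSet {D : ℕ} (b : Fin D → ℝ) (K : ℕ) (T : Finset (Fin D)) : Prop :=
  T.card = K ∧ ∀ i ∈ T, ∀ j ∉ T, |b j| ≤ |b i|

end STG

end

/-! Support recovery reduces to consistency in Euclidean norm: a vector at distance less than η/2
from β* has entries below η/2 off the support and above η/2 on it (`IsTopSet.eq_supp`).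

Consistency comes from a basic inequality. With θ = β*, driving the gates open on the support and
closed elsewhere sends the risk to ‖ε‖²/N + Kλ (`tendsto_risk_open_gates`), so the expected loss of
the near-minimizer is at most this plus r. For every gate value z the loss is quadratic in θ ⊙ z -
β*. If XᵀX/N ≥ κI, averaging over z therefore bounds the mean squared error by a constant (depending
on κ) times ‖Xᵀε‖²/N² + Kλ + r (`IsNearMinimizer.integral_error_le`).

Two probabilistic facts remain. Since E‖Xᵀε‖² ≤ 6L²σ²DN, the noise term is of order D/N. And XᵀX/N ≥
(ρ/8)I with high probability (`measure_exists_sum_sq_lt`): Chernoff bounds in fixed directions decay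
like exp(-cN), which beats the exponential-in-D size of a net of the sphere when D/N → 0.

This controls an average over gate noise, while the estimator uses one fresh draw; independence of
that draw allows Markov's inequality conditionally on the fitted pair (`measure_le_of_indepFun`). -/

namespace STG
section

/-! ### Nets of the unit sphere -/

open Metric Set Module in
/-- Volume bound for the size of a separated set of unit vectors. -/
theorem card_le_of_separated_sphere {E : Type*} [NormedAddCommGroup E] [NormedSpace ℝ E]
    [FiniteDimensional ℝ E] {ε : ℝ} (hε : 0 < ε) (s : Finset E) (hs : ∀ c ∈ s, ‖c‖ = 1)
    (h : ∀ c ∈ s, ∀ d ∈ s, c ≠ d → ε ≤ ‖c - d‖) :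
    (s.card : ℝ) ≤ (1 + 2 / ε) ^ finrank ℝ E := by
  borelize E
  let μ : Measure E := Measure.addHaar
  have hδ : 0 < ε / 2 := by positivity
  have hρ : 0 < 1 + ε / 2 := by positivity
  set A := ⋃ c ∈ s, ball (c : E) (ε / 2) with hA
  have D : Set.Pairwise (s : Set E) (Function.onFun Disjoint fun c => ball (c : E) (ε / 2)) := by
    rintro c hc d hd hcd
    apply ball_disjoint_ball
    rw [dist_eq_norm, add_halves]
    exact h c hc d hd hcd
  have A_subset : A ⊆ ball (0 : E) (1 + ε / 2) := by
    refine iUnion₂_subset fun x hx => ?_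
    apply ball_subset_ball'
    rw [dist_zero_right, hs x hx, add_comm]
  have I : (s.card : ENNReal) * ENNReal.ofReal ((ε / 2) ^ finrank ℝ E) * μ (ball 0 1) ≤
      ENNReal.ofReal ((1 + ε / 2) ^ finrank ℝ E) * μ (ball 0 1) :=
    calc
      (s.card : ENNReal) * ENNReal.ofReal ((ε / 2) ^ finrank ℝ E) * μ (ball 0 1) = μ A := by
        rw [hA, measure_biUnion_finset D fun c _ => measurableSet_ball]
        simp only [μ.addHaar_ball_of_pos _ hδ]
        simp only [Finset.sum_const, nsmul_eq_mul, mul_assoc]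
      _ ≤ μ (ball (0 : E) (1 + ε / 2)) := measure_mono A_subset
      _ = _ := by simp only [μ.addHaar_ball_of_pos _ hρ]
  have J := (ENNReal.mul_le_mul_iff_left (measure_ball_pos _ _ zero_lt_one).ne'
    measure_ball_lt_top.ne).1 I
  have K : (s.card : ℝ) * (ε / 2) ^ finrank ℝ E ≤ (1 + ε / 2) ^ finrank ℝ E := by
    have := ENNReal.toReal_le_of_le_ofReal (pow_nonneg hρ.le _) J
    rwa [ENNReal.toReal_mul, ENNReal.toReal_natCast, ENNReal.toReal_ofReal (by positivity)] at this
  rw [← le_div_iff₀ (by positivity), ← div_pow] at K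
  refine K.trans_eq ?_
  congr 1
  field_simp
  ring

open Module in
/-- The unit sphere has an `ε`-net with at most `(1 + 2 / ε) ^ dim` points. -/
theorem exists_sphere_net (E : Type*) [NormedAddCommGroup E] [NormedSpace ℝ E]
    [FiniteDimensional ℝ E] {ε : ℝ} (hε : 0 < ε) :
    ∃ s : Finset E, (∀ c ∈ s, ‖c‖ = 1) ∧ (∀ u : E, ‖u‖ = 1 → ∃ c ∈ s, ‖u - c‖ < ε) ∧
      (s.card : ℝ) ≤ (1 + 2 / ε) ^ finrank ℝ E := by
  classical
  by_contra! H
  -- Greedy growth: a separated set obeys the volume bound, so by `H` it is not a net and some unit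
  -- vector can be added. Separated sets of every size would then exist, against the same bound.
  have key : ∀ n : ℕ, ∃ s : Finset E, (∀ c ∈ s, ‖c‖ = 1) ∧
      (∀ c ∈ s, ∀ d ∈ s, c ≠ d → ε ≤ ‖c - d‖) ∧ s.card = n := by
    intro n
    induction n with
    | zero => exact ⟨∅, by simp⟩
    | succ n ih =>
      obtain ⟨s, h1, h2, h3⟩ := ih
      have hex : ∃ u : E, ‖u‖ = 1 ∧ ∀ c ∈ s, ε ≤ ‖u - c‖ := by
        by_contra! hc
        exact absurd (card_le_of_separated_sphere hε s h1 h2) (not_le.2 (H s h1 hc))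
      obtain ⟨u, hu, huc⟩ := hex
      have hus : u ∉ s := fun hm => by
        have := huc u hm
        simp at this
        linarith
      refine ⟨insert u s, ?_, ?_, by simp [hus, h3]⟩
      · simpa [hu] using h1
      · intro c hc d hd hcd
        rw [Finset.mem_insert] at hc hd
        rcases hc with rfl | hc <;> rcases hd with rfl | hd
        · exact absurd rfl hcd
        · exact huc d hd
        · rw [norm_sub_rev]; exact huc c hc
        · exact h2 c hc d hd hcd
  obtain ⟨n, hn⟩ := exists_nat_gt ((1 + 2 / ε) ^ finrank ℝ E)
  obtain ⟨s, h1, h2, h3⟩ := key n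
  have := card_le_of_separated_sphere hε s h1 h2
  rw [h3] at this
  linarith

/-! ### Moments of sub-Gaussian variables -/

section SubGaussianScalar

variable {Ω : Type*} [MeasurableSpace Ω] {P : Measure Ω} [IsProbabilityMeasure P]
  {f : Ω → ℝ} {L : ℝ}

/-- Layer-cake formula for f². The rate a = 1/(2L²) is half the rate of the tail of f², so the
integrand is dominated by 2a·exp(-at), of integral 2. -/
theorem lintegral_exp_sq_sub_one_le (hf : Measurable f) (hL : 0 < L)
    (htail : ∀ t : ℝ, 0 ≤ t → P.real {ω | t < |f ω|} ≤ 2 * Real.exp (-t ^ 2 / L ^ 2)) :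
    ∫⁻ ω, ENNReal.ofReal (Real.exp (f ω ^ 2 / (2 * L ^ 2)) - 1) ∂P ≤ 2 := by
  set a : ℝ := 1 / (2 * L ^ 2) with ha
  have ha0 : 0 < a := by positivity
  have hprim : ∀ s : ℝ, ∫ t in (0 : ℝ)..s, a * Real.exp (a * t) = Real.exp (a * s) - 1 := by
    intro s
    have hd : ∀ t ∈ Set.uIcc 0 s, HasDerivAt (fun t => Real.exp (a * t)) (a * Real.exp (a * t)) t := by
      intro t _
      have := ((hasDerivAt_id t).const_mul a).exp
      simpa [mul_comm] using this
    rw [intervalIntegral.integral_eq_sub_of_hasDerivAt hd (by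
      apply Continuous.intervalIntegrable; fun_prop)]
    simp
  have hlc := lintegral_comp_eq_lintegral_meas_lt_mul (μ := P) (f := fun ω => f ω ^ 2)
    (g := fun t => a * Real.exp (a * t)) (ae_of_all _ fun ω => sq_nonneg _)
    (hf.pow_const 2).aemeasurable
    (fun t _ => by apply Continuous.intervalIntegrable; fun_prop)
    (ae_of_all _ fun t => by positivity)
  simp only [hprim] at hlc
  have e1 : ∀ ω, f ω ^ 2 / (2 * L ^ 2) = a * f ω ^ 2 := fun ω => by rw [ha]; ring
  simp only [e1]
  rw [hlc]
  calc ∫⁻ t in Set.Ioi 0, P {ω | t < f ω ^ 2} * ENNReal.ofReal (a * Real.exp (a * t))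
      ≤ ∫⁻ t in Set.Ioi 0, ENNReal.ofReal (2 * a * Real.exp (-a * t)) := by
        refine setLIntegral_mono (by fun_prop) fun t ht => ?_
        have ht0 : (0 : ℝ) ≤ t := le_of_lt ht
        have hset : {ω | t < f ω ^ 2} = {ω | Real.sqrt t < |f ω|} := by
          ext ω
          simp only [Set.mem_ofPred_eq]
          rw [← Real.sqrt_sq_eq_abs, Real.sqrt_lt_sqrt_iff ht0]
        have hp : P {ω | t < f ω ^ 2} ≤ ENNReal.ofReal (2 * Real.exp (-t / L ^ 2)) := by
          rw [hset, ← ofReal_measureReal]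
          refine ENNReal.ofReal_le_ofReal ?_
          have := htail (Real.sqrt t) (Real.sqrt_nonneg t)
          rwa [Real.sq_sqrt ht0] at this
        calc _ ≤ ENNReal.ofReal (2 * Real.exp (-t / L ^ 2)) * ENNReal.ofReal (a * Real.exp (a * t)) := by
              gcongr
          _ = _ := by
              rw [← ENNReal.ofReal_mul (by positivity)]
              congr 1
              have : Real.exp (-a * t) = Real.exp (-t / L ^ 2) * Real.exp (a * t) := by
                rw [← Real.exp_add, ha]; congr 1; field_simp; ring
              rw [this]; ring
    _ = ENNReal.ofReal (∫ t in Set.Ioi 0, 2 * a * Real.exp (-a * t)) := by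
        rw [ofReal_integral_eq_lintegral_ofReal]
        · exact ((integrableOn_exp_mul_Ioi (by linarith : -a < 0) 0).const_mul _)
        · exact ae_of_all _ fun t => by positivity
    _ = 2 := by
        rw [integral_const_mul, integral_exp_mul_Ioi (by linarith : -a < 0)]
        simp only [mul_zero, Real.exp_zero]
        rw [show 2 * a * (-1 / -a) = 2 by field_simp]
        simp

theorem integrable_exp_sq (hf : Measurable f) (hL : 0 < L)
    (htail : ∀ t : ℝ, 0 ≤ t → P.real {ω | t < |f ω|} ≤ 2 * Real.exp (-t ^ 2 / L ^ 2)) :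
    Integrable (fun ω => Real.exp (f ω ^ 2 / (2 * L ^ 2))) P ∧
      ∫ ω, Real.exp (f ω ^ 2 / (2 * L ^ 2)) ∂P ≤ 3 := by
  have h := lintegral_exp_sq_sub_one_le hf hL htail
  have hnn : ∀ ω, 0 ≤ Real.exp (f ω ^ 2 / (2 * L ^ 2)) - 1 := fun ω => by
    have := Real.one_le_exp (show 0 ≤ f ω ^ 2 / (2 * L ^ 2) by positivity)
    linarith
  have hint : Integrable (fun ω => Real.exp (f ω ^ 2 / (2 * L ^ 2)) - 1) P := by
    refine ⟨by fun_prop, ?_⟩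
    rw [hasFiniteIntegral_iff_ofReal (ae_of_all _ hnn)]
    exact h.trans_lt (by simp)
  have hint' : Integrable (fun ω => Real.exp (f ω ^ 2 / (2 * L ^ 2))) P := by
    refine (hint.add (integrable_const 1)).congr (ae_of_all _ fun ω => ?_)
    simp
  refine ⟨hint', ?_⟩
  have h2 : ∫ ω, (Real.exp (f ω ^ 2 / (2 * L ^ 2)) - 1) ∂P ≤ 2 := by
    rw [integral_eq_lintegral_of_nonneg_ae (ae_of_all _ hnn) (by fun_prop)]
    exact ENNReal.toReal_le_of_le_ofReal (by norm_num) (by simpa using h)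
  rw [integral_sub hint' (integrable_const 1)] at h2
  simp at h2
  linarith

theorem sq_le_mul_exp (z c : ℝ) (hc : 0 < c) : z ^ 2 ≤ c * Real.exp (z ^ 2 / c) := by
  have := Real.add_one_le_exp (z ^ 2 / c)
  calc z ^ 2 = c * (z ^ 2 / c) := by field_simp
    _ ≤ _ := by gcongr; linarith

theorem integrable_sq (hf : Measurable f) (hL : 0 < L)
    (htail : ∀ t : ℝ, 0 ≤ t → P.real {ω | t < |f ω|} ≤ 2 * Real.exp (-t ^ 2 / L ^ 2)) :
    Integrable (fun ω => f ω ^ 2) P ∧ ∫ ω, f ω ^ 2 ∂P ≤ 6 * L ^ 2 := by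
  obtain ⟨h1, h2⟩ := integrable_exp_sq hf hL htail
  have hb : ∀ ω, f ω ^ 2 ≤ 2 * L ^ 2 * Real.exp (f ω ^ 2 / (2 * L ^ 2)) := fun ω =>
    sq_le_mul_exp _ _ (by positivity)
  have hi : Integrable (fun ω => f ω ^ 2) P := by
    refine (h1.const_mul (2 * L ^ 2)).mono' (by fun_prop) (ae_of_all _ fun ω => ?_)
    rw [Real.norm_of_nonneg (sq_nonneg _)]; exact hb ω
  refine ⟨hi, ?_⟩
  calc _ ≤ ∫ ω, 2 * L ^ 2 * Real.exp (f ω ^ 2 / (2 * L ^ 2)) ∂P :=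
        integral_mono hi (h1.const_mul _) hb
    _ ≤ _ := by rw [integral_const_mul]; nlinarith [sq_nonneg L]

/-- Uses z²/2 ≤ exp z at z = f²/(2L²); the constant is 24 = 8 · 3. -/
theorem integrable_pow_four (hf : Measurable f) (hL : 0 < L)
    (htail : ∀ t : ℝ, 0 ≤ t → P.real {ω | t < |f ω|} ≤ 2 * Real.exp (-t ^ 2 / L ^ 2)) :
    Integrable (fun ω => f ω ^ 4) P ∧ ∫ ω, f ω ^ 4 ∂P ≤ 24 * L ^ 4 := by
  obtain ⟨h1, h2⟩ := integrable_exp_sq hf hL htail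
  have hb : ∀ ω, f ω ^ 4 ≤ 8 * L ^ 4 * Real.exp (f ω ^ 2 / (2 * L ^ 2)) := fun ω => by
    have := Real.quadratic_le_exp_of_nonneg (show 0 ≤ f ω ^ 2 / (2 * L ^ 2) by positivity)
    calc f ω ^ 4 = 8 * L ^ 4 * ((f ω ^ 2 / (2 * L ^ 2)) ^ 2 / 2) := by field_simp; ring
      _ ≤ _ := by
        gcongr
        have : 0 ≤ f ω ^ 2 / (2 * L ^ 2) := by positivity
        linarith
  have hi : Integrable (fun ω => f ω ^ 4) P := by
    refine (h1.const_mul (8 * L ^ 4)).mono' (by fun_prop) (ae_of_all _ fun ω => ?_)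
    rw [Real.norm_of_nonneg (by positivity)]; exact hb ω
  refine ⟨hi, ?_⟩
  calc _ ≤ ∫ ω, 8 * L ^ 4 * Real.exp (f ω ^ 2 / (2 * L ^ 2)) ∂P :=
        integral_mono hi (h1.const_mul _) hb
    _ ≤ _ := by
      rw [integral_const_mul]
      have : 0 ≤ L ^ 4 := by positivity
      nlinarith

/-- Bound on the Laplace transform of the square of a sub-Gaussian variable. -/
theorem mgf_neg_sq_le (hf : Measurable f) (hL : 0 < L)
    (htail : ∀ t : ℝ, 0 ≤ t → P.real {ω | t < |f ω|} ≤ 2 * Real.exp (-t ^ 2 / L ^ 2))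
    {ρ : ℝ} (hρ : ρ ≤ ∫ ω, f ω ^ 2 ∂P) {s : ℝ} (hs : 0 ≤ s) :
    mgf (fun ω => f ω ^ 2) P (-s) ≤ Real.exp (-s * ρ + 12 * s ^ 2 * L ^ 4) := by
  obtain ⟨h1, -⟩ := integrable_sq hf hL htail
  obtain ⟨h2, h3⟩ := integrable_pow_four hf hL htail
  -- Follows from exp z ≥ 1 + z + z²/2 and (1 + z + z²/2)(1 - z + z²/2) = 1 + z⁴/4 ≥ 1.
  have hb : ∀ z : ℝ, 0 ≤ z → Real.exp (-z) ≤ 1 - z + z ^ 2 / 2 := by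
    intro z hz
    have h := Real.quadratic_le_exp_of_nonneg hz
    rw [Real.exp_neg]
    refine inv_le_of_inv_le₀ (by nlinarith [sq_nonneg (z - 1)]) (le_trans ?_ h)
    rw [inv_le_iff_one_le_mul₀ (by nlinarith [sq_nonneg (z - 1)])]
    nlinarith [sq_nonneg (z ^ 2)]
  have hle : mgf (fun ω => f ω ^ 2) P (-s) ≤
      ∫ ω, (1 - s * f ω ^ 2 + s ^ 2 / 2 * f ω ^ 4) ∂P := by
    refine integral_mono_of_nonneg (ae_of_all _ fun ω => (Real.exp_pos _).le)
      (((integrable_const 1).sub (h1.const_mul s)).add (h2.const_mul _)) (ae_of_all _ fun ω => ?_)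
    have := hb (s * f ω ^ 2) (by positivity)
    simp only [neg_mul]
    refine this.trans_eq (by ring)
  have h7 : Integrable (fun ω => 1 - s * f ω ^ 2) P := (integrable_const 1).sub (h1.const_mul s)
  rw [integral_add h7 (h2.const_mul _), integral_sub (integrable_const 1) (h1.const_mul s), integral_const_mul, integral_const_mul] at hle
  simp only [integral_const, probReal_univ, smul_eq_mul, mul_one] at hle
  have h4 := Real.add_one_le_exp (-s * ρ + 12 * s ^ 2 * L ^ 4)
  have h5 : s * ρ ≤ s * ∫ ω, f ω ^ 2 ∂P := by gcongr
  have h6 : s ^ 2 / 2 * ∫ ω, f ω ^ 4 ∂P ≤ s ^ 2 / 2 * (24 * L ^ 4) := by gcongr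
  linarith

end SubGaussianScalar

/-! ### Smallest eigenvalue and quadratic form -/

/-- The smallest eigenvalue bounds the quadratic form from below. -/
theorem rhoMin_mul_le {D : ℕ} {A : Matrix (Fin D) (Fin D) ℝ} (hA : A.IsHermitian) {ρ : ℝ}
    (hρ : ρ ≤ rhoMin A) (u : Fin D → ℝ) : ρ * ∑ j, u j ^ 2 ≤ ∑ j, ∑ k, u j * u k * A j k := by
  have hbdd : BddBelow {r : ℝ | Module.End.HasEigenvalue (Matrix.toLin' A) r} :=
    (Module.End.finite_hasEigenvalue (Matrix.toLin' A)).bddBelow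
  have hev : ∀ r, Module.End.HasEigenvalue (Matrix.toLin' A) r → ρ ≤ r := fun r hr =>
    hρ.trans (csInf_le hbdd hr)
  have hH : (A - ρ • (1 : Matrix (Fin D) (Fin D) ℝ)).IsHermitian := by
    refine hA.sub ?_
    simp [Matrix.IsHermitian]
  -- Eigenvectors of A - ρI are eigenvectors of A with eigenvalue shifted by ρ, so its spectrum is
  -- nonnegative.
  have hps : (A - ρ • (1 : Matrix (Fin D) (Fin D) ℝ)).PosSemidef := by
    refine hH.posSemidef_iff_eigenvalues_nonneg.2 fun i => ?_
    have h1 := hH.mulVec_eigenvectorBasis i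
    set v := hH.eigenvectorBasis i with hv
    have hv0 : (v : Fin D → ℝ) ≠ 0 := by
      have := hH.eigenvectorBasis.orthonormal.ne_zero i
      intro h0
      apply this
      ext j
      exact congrFun h0 j
    have h2 : A.mulVec v = (hH.eigenvalues i + ρ) • (v : Fin D → ℝ) := by
      rw [Matrix.sub_mulVec, Matrix.smul_mulVec, Matrix.one_mulVec, sub_eq_iff_eq_add] at h1
      rw [h1, add_smul]
    have := hev (hH.eigenvalues i + ρ)
      (Module.End.hasEigenvalue_of_hasEigenvector (x := (v : Fin D → ℝ))
        ⟨Module.End.mem_eigenspace_iff.2 (by simpa using h2), hv0⟩)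
    simp only [Pi.zero_apply]
    linarith
  have := hps.dotProduct_mulVec_nonneg u
  simp only [star_trivial, Matrix.sub_mulVec, Matrix.smul_mulVec, Matrix.one_mulVec,
    dotProduct_sub, dotProduct_smul, smul_eq_mul] at this
  have e1 : u ⬝ᵥ u = ∑ j, u j ^ 2 := by simp [dotProduct, sq]
  have e2 : u ⬝ᵥ A.mulVec u = ∑ j, ∑ k, u j * u k * A j k := by
    simp only [dotProduct, Matrix.mulVec, Finset.mul_sum]
    refine Finset.sum_congr rfl fun j _ => Finset.sum_congr rfl fun k _ => by ring
  rw [e1, e2] at this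
  linarith

end
section

/-! ### Lower bound for the empirical second moment matrix -/

/-- A linear map that is bounded below and above on a fine net of the unit sphere is bounded
below everywhere. -/
theorem lower_bound_of_net {E F : Type*} [NormedAddCommGroup E] [NormedSpace ℝ E]
    [NormedAddCommGroup F] [NormedSpace ℝ F] (T : E →L[ℝ] F) {s : Finset E} {ε a b : ℝ}
    (hnet : ∀ u : E, ‖u‖ = 1 → ∃ c ∈ s, ‖u - c‖ < ε)
    (hε : ε ≤ 1 / 2) (hb0 : 0 ≤ b) (hab : ε * (2 * b) ≤ a / 2)
    (ha : ∀ c ∈ s, a ≤ ‖T c‖) (hb : ∀ c ∈ s, ‖T c‖ ≤ b) (u : E) : a / 2 * ‖u‖ ≤ ‖T u‖ := by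
  -- Approximating by net points gives ‖T‖ ≤ b + ‖T‖/2, which is then solved for ‖T‖.
  have hop : ‖T‖ ≤ 2 * b := by
    have : ‖T‖ ≤ b + 1 / 2 * ‖T‖ := by
      refine T.opNorm_le_of_unit_norm (by positivity) fun u hu => ?_
      obtain ⟨c, hc, huc⟩ := hnet u hu
      calc ‖T u‖ = ‖T c + T (u - c)‖ := by rw [← map_add]; simp
        _ ≤ ‖T c‖ + ‖T (u - c)‖ := norm_add_le _ _
        _ ≤ b + ‖T‖ * ‖u - c‖ := add_le_add (hb c hc) (T.le_opNorm _)
        _ ≤ b + ‖T‖ * (1 / 2) := by gcongr; linarith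
        _ = _ := by ring
    linarith
  have hunit : ∀ u : E, ‖u‖ = 1 → a / 2 ≤ ‖T u‖ := by
    intro u hu
    obtain ⟨c, hc, huc⟩ := hnet u hu
    have h1 : ‖T c‖ ≤ ‖T u‖ + ‖T (u - c)‖ := by
      calc ‖T c‖ = ‖T u - T (u - c)‖ := by rw [← map_sub]; simp
        _ ≤ _ := norm_sub_le _ _
    have h2 : ‖T (u - c)‖ ≤ 2 * b * ε :=
      (T.le_opNorm _).trans (mul_le_mul hop huc.le (norm_nonneg _) (by positivity))
    have := ha c hc
    linarith
  rcases eq_or_ne u 0 with rfl | hu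
  · simp
  · have hu0 : 0 < ‖u‖ := norm_pos_iff.2 hu
    have h := hunit ((‖u‖)⁻¹ • u) (by rw [norm_smul, norm_inv, norm_norm, inv_mul_cancel₀ hu0.ne'])
    rw [map_smul, norm_smul, norm_inv, norm_norm, inv_mul_eq_div, le_div_iff₀ hu0] at h
    exact h

theorem measurable_marginal {Ω : Type*} [MeasurableSpace Ω] {D : ℕ} {ξ : Ω → Fin D → ℝ} (hξ : Measurable ξ) (u : Fin D → ℝ) :
    Measurable fun ω => ∑ j, ξ ω j * u j := by fun_prop

/-- Coordinates of a sub-Gaussian vector are sub-Gaussian. -/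
theorem IsSubGaussianVec.coord {Ω : Type*} [MeasurableSpace Ω] {P : Measure Ω} {D : ℕ} {L : ℝ}
    {ξ : Ω → Fin D → ℝ} (h : IsSubGaussianVec P L ξ) (j : Fin D)
    (t : ℝ) (ht : 0 ≤ t) : P.real {ω | t < |ξ ω j|} ≤ 2 * Real.exp (-t ^ 2 / L ^ 2) := by
  have := h (EuclideanSpace.single j 1) (by simp) t ht
  simpa [Pi.single_apply] using this

variable {Ω : Type*} [MeasurableSpace Ω] {P : Measure Ω} [IsProbabilityMeasure P]
  {N D : ℕ} {x : Fin N → Ω → Fin D → ℝ} {L ρ : ℝ}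

/-- Chernoff bound for the lower tail of the empirical second moment along a unit vector. -/
theorem measure_sum_sq_le (hx : ∀ i, Measurable (x i)) (hind : iIndepFun x P) (hL : 0 < L)
    (hsub : ∀ i, IsSubGaussianVec P L (x i)) (hρ0 : 0 ≤ ρ)
    {u : EuclideanSpace ℝ (Fin D)} (hu : ‖u‖ = 1)
    (hρ : ∀ i, ρ ≤ ∫ ω, (∑ j, x i ω j * u j) ^ 2 ∂P) :
    P.real {ω | ∑ i, (∑ j, x i ω j * u j) ^ 2 ≤ N * (ρ / 2)} ≤
      Real.exp (-(ρ ^ 2 / (192 * L ^ 4)) * N) := by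
  set Y : Fin N → Ω → ℝ := fun i ω => (∑ j, x i ω j * u j) ^ 2 with hY
  have hYm : ∀ i, Measurable (Y i) := fun i => (measurable_marginal (hx i) u).pow_const 2
  have hYind : iIndepFun Y P :=
    hind.comp (fun _ (v : Fin D → ℝ) => (∑ j, v j * u j) ^ 2) fun _ => by fun_prop
  -- Minimizes the Chernoff exponent N(-sρ/2 + 12s²L⁴).
  set s : ℝ := ρ / (48 * L ^ 4) with hs
  have hs0 : 0 ≤ s := by positivity
  have hint : ∀ i, Integrable (fun ω => Real.exp (-s * Y i ω)) P := fun i => by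
    refine Integrable.mono' (integrable_const 1) (by have := hYm i; fun_prop)
      (ae_of_all _ fun ω => ?_)
    rw [Real.norm_of_nonneg (Real.exp_pos _).le, Real.exp_le_one_iff]
    have : 0 ≤ s * Y i ω := mul_nonneg hs0 (sq_nonneg _)
    linarith
  have h1 := measure_le_le_exp_mul_mgf (μ := P) (X := ∑ i, Y i) (t := -s) (N * (ρ / 2))
    (by linarith) (hYind.integrable_exp_mul_sum hYm fun i _ => hint i)
  rw [hYind.mgf_sum hYm] at h1
  have h2 : ∏ i, mgf (Y i) P (-s) ≤ ∏ _i : Fin N, Real.exp (-s * ρ + 12 * s ^ 2 * L ^ 4) :=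
    Finset.prod_le_prod (fun i _ => mgf_nonneg) fun i _ =>
      mgf_neg_sq_le (measurable_marginal (hx i) u) hL (hsub i u hu) (hρ i) hs0
  rw [Finset.prod_const, Finset.card_univ, Fintype.card_fin, ← Real.exp_nat_mul] at h2
  calc _ = P.real {ω | (∑ i, Y i) ω ≤ N * (ρ / 2)} := by simp [hY]
    _ ≤ _ := h1
    _ ≤ Real.exp (- -s * (N * (ρ / 2))) * Real.exp (N * (-s * ρ + 12 * s ^ 2 * L ^ 4)) := by gcongr
    _ = _ := by
      rw [← Real.exp_add, hs]
      congr 1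
      field_simp
      ring

/-- Chernoff bound for the upper tail of the empirical second moment along a unit vector. -/
theorem measure_le_sum_sq (hx : ∀ i, Measurable (x i)) (hind : iIndepFun x P) (hL : 0 < L)
    (hsub : ∀ i, IsSubGaussianVec P L (x i)) {u : EuclideanSpace ℝ (Fin D)} (hu : ‖u‖ = 1) :
    P.real {ω | N * (6 * L ^ 2) ≤ ∑ i, (∑ j, x i ω j * u j) ^ 2} ≤ Real.exp (-N) := by
  set Y : Fin N → Ω → ℝ := fun i ω => (∑ j, x i ω j * u j) ^ 2 with hY
  have hYm : ∀ i, Measurable (Y i) := fun i => (measurable_marginal (hx i) u).pow_const 2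
  have hYind : iIndepFun Y P :=
    hind.comp (fun _ (v : Fin D → ℝ) => (∑ j, v j * u j) ^ 2) fun _ => by fun_prop
  -- At this s each factor is at most 3 ≤ e², while the threshold 6L² contributes e⁻³ per sample.
  set s : ℝ := 1 / (2 * L ^ 2) with hs
  have hs0 : 0 ≤ s := by positivity
  have hexp : ∀ i, (fun ω => Real.exp (s * Y i ω)) =
      fun ω => Real.exp ((∑ j, x i ω j * u j) ^ 2 / (2 * L ^ 2)) := fun i => by
    funext ω
    rw [hs, hY, div_mul_eq_mul_div, one_mul]
  have hint : ∀ i, Integrable (fun ω => Real.exp (s * Y i ω)) P := fun i => by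
    rw [hexp]
    exact (integrable_exp_sq (measurable_marginal (hx i) u) hL (hsub i u hu)).1
  have hmgf : ∀ i, mgf (Y i) P s ≤ 3 := fun i => by
    rw [mgf, hexp]
    exact (integrable_exp_sq (measurable_marginal (hx i) u) hL (hsub i u hu)).2
  have h1 := measure_ge_le_exp_mul_mgf (μ := P) (X := ∑ i, Y i) (t := s) (N * (6 * L ^ 2))
    hs0 (hYind.integrable_exp_mul_sum hYm fun i _ => hint i)
  rw [hYind.mgf_sum hYm] at h1
  have h3 : (3 : ℝ) ≤ Real.exp 2 := by
    have := Real.add_one_le_exp (2 : ℝ)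
    linarith
  have h2 : ∏ i, mgf (Y i) P s ≤ ∏ _i : Fin N, Real.exp 2 :=
    Finset.prod_le_prod (fun i _ => mgf_nonneg) fun i _ => (hmgf i).trans h3
  rw [Finset.prod_const, Finset.card_univ, Fintype.card_fin, ← Real.exp_nat_mul] at h2
  calc _ = P.real {ω | N * (6 * L ^ 2) ≤ (∑ i, Y i) ω} := by simp [hY]
    _ ≤ _ := h1
    _ ≤ Real.exp (-s * (N * (6 * L ^ 2))) * Real.exp (N * 2) := by gcongr
    _ = _ := by
      rw [← Real.exp_add, hs]
      congr 1
      field_simp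
      ring

/-- Restricted eigenvalue bound: with high probability the empirical second moment matrix of a
sub-Gaussian sample is bounded below by a multiple of the population bound. -/
theorem measure_exists_sum_sq_lt (hx : ∀ i, Measurable (x i)) (hind : iIndepFun x P) (hL : 0 < L)
    (hsub : ∀ i, IsSubGaussianVec P L (x i)) (hρ0 : 0 ≤ ρ)
    (hρ : ∀ i, ∀ u : EuclideanSpace ℝ (Fin D), ‖u‖ = 1 → ρ ≤ ∫ ω, (∑ j, x i ω j * u j) ^ 2 ∂P)
    {ε : ℝ} (hε0 : 0 < ε) (hε : ε ≤ 1 / 2)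
    (hερ : ε * (2 * √(6 * L ^ 2)) ≤ √(ρ / 2) / 2) :
    P.real {ω | ∃ u : Fin D → ℝ, ∑ i, (∑ j, x i ω j * u j) ^ 2 < N * (ρ / 8) * ∑ j, u j ^ 2} ≤
      (1 + 2 / ε) ^ D * (Real.exp (-(ρ ^ 2 / (192 * L ^ 4)) * N) + Real.exp (-N)) := by
  obtain ⟨s, hs1, hsnet, hscard⟩ := exists_sphere_net (EuclideanSpace ℝ (Fin D)) hε0
  rw [finrank_euclideanSpace_fin] at hscard
  set B : EuclideanSpace ℝ (Fin D) → Set Ω := fun u =>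
    {ω | ∑ i, (∑ j, x i ω j * u j) ^ 2 ≤ N * (ρ / 2)} ∪
      {ω | N * (6 * L ^ 2) ≤ ∑ i, (∑ j, x i ω j * u j) ^ 2} with hB
  have hsubset : {ω | ∃ u : Fin D → ℝ,
      ∑ i, (∑ j, x i ω j * u j) ^ 2 < N * (ρ / 8) * ∑ j, u j ^ 2} ⊆ ⋃ u ∈ s, B u := by
    rintro ω ⟨u, hu⟩
    by_contra hω
    simp only [Set.mem_iUnion, not_exists, hB, Set.mem_union, Set.mem_ofPred_eq, not_or,
      not_le] at hω
    set T : EuclideanSpace ℝ (Fin D) →L[ℝ] EuclideanSpace ℝ (Fin N) :=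
      (Matrix.toEuclideanLin (Matrix.of fun i => x i ω)).toContinuousLinearMap with hT
    have hTn : ∀ v : EuclideanSpace ℝ (Fin D), ‖T v‖ ^ 2 = ∑ i, (∑ j, x i ω j * v j) ^ 2 := by
      intro v
      rw [EuclideanSpace.real_norm_sq_eq]
      rfl
    -- Passing from the net to the sphere halves the lower bound √(Nρ/2); squaring gives Nρ/8.
    have hlow := lower_bound_of_net T (a := √(N * (ρ / 2))) (b := √(N * (6 * L ^ 2))) hsnet hε
      (Real.sqrt_nonneg _) (by
        rw [Real.sqrt_mul (Nat.cast_nonneg _), Real.sqrt_mul (Nat.cast_nonneg _)]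
        have := mul_le_mul_of_nonneg_left hερ (Real.sqrt_nonneg (N : ℝ))
        linarith)
      (fun c hc => by
        rw [Real.sqrt_le_left (norm_nonneg _), hTn]
        exact (hω c hc).1.le)
      (fun c hc => by
        apply Real.le_sqrt_of_sq_le
        rw [hTn]
        exact (hω c hc).2.le) (WithLp.toLp 2 u)
    have h2 := pow_le_pow_left₀ (by positivity) hlow 2
    rw [hTn, mul_pow, div_pow, Real.sq_sqrt (by positivity), EuclideanSpace.real_norm_sq_eq] at h2
    simp only at h2
    linarith
  calc _ ≤ P.real (⋃ u ∈ s, B u) := measureReal_mono hsubset (measure_ne_top _ _)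
    _ ≤ ∑ u ∈ s, P.real (B u) := measureReal_biUnion_finset_le _ _
    _ ≤ ∑ _u ∈ s, (Real.exp (-(ρ ^ 2 / (192 * L ^ 4)) * N) + Real.exp (-N)) :=
        Finset.sum_le_sum fun u hu => (measureReal_union_le _ _).trans
          (add_le_add (measure_sum_sq_le hx hind hL hsub hρ0 (hs1 u hu) fun i => hρ i u (hs1 u hu))
            (measure_le_sum_sq hx hind hL hsub (hs1 u hu)))
    _ = s.card * (Real.exp (-(ρ ^ 2 / (192 * L ^ 4)) * N) + Real.exp (-N)) := by
        rw [Finset.sum_const, nsmul_eq_mul]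
    _ ≤ _ := by gcongr

theorem IsSubGaussianVec.memLp {ξ : Ω → Fin D → ℝ} (h : IsSubGaussianVec P L ξ) (hL : 0 < L)
    (hξ : Measurable ξ) (j : Fin D) : MemLp (fun ω => ξ ω j) 2 P :=
  (memLp_two_iff_integrable_sq (by fun_prop)).2
    (integrable_sq (by fun_prop) hL (h.coord j)).1

/-- Second moments of the marginals in terms of mean and covariance. -/
theorem integral_marginal_sq {ξ : Ω → Fin D → ℝ} (hξ : ∀ j, MemLp (fun ω => ξ ω j) 2 P)
    {m : Fin D → ℝ} {S : Matrix (Fin D) (Fin D) ℝ} (hm : ∀ j, ∫ ω, ξ ω j ∂P = m j)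
    (hS : ∀ j k, covariance (fun ω => ξ ω j) (fun ω => ξ ω k) P = S j k) (u : Fin D → ℝ) :
    ∫ ω, (∑ j, ξ ω j * u j) ^ 2 ∂P =
      ∑ j, ∑ k, u j * u k * (S + Matrix.vecMulVec m m) j k := by
  have hi : ∀ j k, Integrable (fun ω => u j * u k * (ξ ω j * ξ ω k)) P := fun j k =>
    ((hξ j).integrable_mul (hξ k)).const_mul _
  have he : ∀ ω, (∑ j, ξ ω j * u j) ^ 2 = ∑ j, ∑ k, u j * u k * (ξ ω j * ξ ω k) := by
    intro ω
    rw [sq, Finset.sum_mul_sum]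
    exact Finset.sum_congr rfl fun j _ => Finset.sum_congr rfl fun k _ => by ring
  simp only [he]
  rw [integral_finsetSum _ fun j _ => integrable_finsetSum _ fun k _ => hi j k]
  refine Finset.sum_congr rfl fun j _ => ?_
  rw [integral_finsetSum _ fun k _ => hi j k]
  refine Finset.sum_congr rfl fun k _ => ?_
  rw [integral_const_mul]
  congr 1
  have := covariance_eq_sub (hξ j) (hξ k)
  rw [hS, hm, hm] at this
  rw [Matrix.add_apply, Matrix.vecMulVec_apply, this]
  simp

end
section

/-! ### Noise terms, conditional Markov inequality, top entries -/

instance (n : ℕ) (s : ℝ≥0) : IsProbabilityMeasure (gaussianVec n s) := by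
  unfold gaussianVec
  infer_instance

theorem memLp_eval_gaussianVec {n : ℕ} (s : ℝ≥0) (i : Fin n) :
    MemLp (fun v : Fin n → ℝ => v i) 2 (gaussianVec n s) :=
  (memLp_id_gaussianReal (μ := 0) (v := s ^ 2) 2).comp_measurePreserving
    (measurePreserving_eval (fun _ : Fin n => gaussianReal 0 (s ^ 2)) i)

theorem integral_eval_mul_eval_gaussianVec {n : ℕ} (s : ℝ≥0) (i k : Fin n) :
    ∫ v : Fin n → ℝ, v i * v k ∂(gaussianVec n s) = if i = k then (s : ℝ) ^ 2 else 0 := by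
  have hmp := fun i => measurePreserving_eval (fun _ : Fin n => gaussianReal 0 (s ^ 2)) i
  have hmean : ∀ i, ∫ v : Fin n → ℝ, v i ∂(gaussianVec n s) = 0 := fun i => by
    have := integral_map (μ := gaussianVec n s) (φ := fun v : Fin n → ℝ => v i) (f := fun t : ℝ => t)
      (measurable_pi_apply i).aemeasurable (by fun_prop)
    rw [← this]
    have h2 := (hmp i).map_eq
    unfold gaussianVec
    rw [show (fun v : Fin n → ℝ => v i) = Function.eval i from rfl, h2]
    exact integral_id_gaussianReal
  split_ifs with h
  · subst h
    have hv := variance_map (μ := gaussianVec n s) (Y := fun v : Fin n → ℝ => v i)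
      (X := id) (by fun_prop) (measurable_pi_apply i).aemeasurable
    have h2 := (hmp i).map_eq
    rw [gaussianVec, show (fun v : Fin n → ℝ => v i) = Function.eval i from rfl, h2,
      variance_id_gaussianReal] at hv
    have h3 := variance_of_integral_eq_zero (X := fun v : Fin n → ℝ => v i)
      (μ := gaussianVec n s) (measurable_pi_apply i).aemeasurable (hmean i)
    have h4 : (fun v : Fin n → ℝ => v i * v i) = fun v => v i ^ 2 := by funext v; ring
    rw [h4, ← h3]
    rw [gaussianVec]
    refine Eq.trans ?_ (hv.symm.trans ?_)
    · rfl
    · simp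
  · have hind : IndepFun (fun v : Fin n → ℝ => v i) (fun v => v k) (gaussianVec n s) :=
      (iIndepFun_pi (X := fun _ (t : ℝ) => t) (μ := fun _ : Fin n => gaussianReal 0 (s ^ 2))
        (fun _ => by fun_prop)).indepFun h
    have := hind.integral_fun_mul_eq_mul_integral
      (measurable_pi_apply i).aestronglyMeasurable (measurable_pi_apply k).aestronglyMeasurable
    rw [this, hmean, zero_mul]

/-- Second moment of the correlation between the columns of the design and the noise. -/
theorem integral_sum_sq_design_noise_le {Ω : Type*} [MeasurableSpace Ω] {P : Measure Ω}
    [IsProbabilityMeasure P] {N D : ℕ} {x : Fin N → Ω → Fin D → ℝ} {L : ℝ} (hL : 0 < L)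
    (hx : ∀ i, Measurable (x i)) (hsub : ∀ i, IsSubGaussianVec P L (x i))
    {e : Ω → Fin N → ℝ} (he : Measurable e) {σ : ℝ≥0} (hlaw : P.map e = gaussianVec N σ)
    (hind : IndepFun (fun ω i => x i ω) e P) :
    Integrable (fun ω => ∑ j, (∑ i, x i ω j * e ω i) ^ 2) P ∧
    ∫ ω, ∑ j, (∑ i, x i ω j * e ω i) ^ 2 ∂P ≤ (D : ℝ) * N * (6 * L ^ 2 * σ ^ 2) := by
  have hee : ∀ i k, Integrable (fun ω => e ω i * e ω k) P ∧
      ∫ ω, e ω i * e ω k ∂P = if i = k then (σ : ℝ) ^ 2 else 0 := by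
    intro i k
    have hi : Integrable (fun v : Fin N → ℝ => v i * v k) (P.map e) := by
      rw [hlaw]
      exact (memLp_eval_gaussianVec σ i).integrable_mul (memLp_eval_gaussianVec σ k)
    refine ⟨hi.comp_measurable he, ?_⟩
    rw [← integral_eval_mul_eval_gaussianVec, ← hlaw, integral_map he.aemeasurable (by fun_prop)]
  have hxx : ∀ i k j, Integrable (fun ω => x i ω j * x k ω j) P := fun i k j =>
    ((hsub i).memLp hL (hx i) j).integrable_mul ((hsub k).memLp hL (hx k) j)
  have hindep : ∀ i k j, IndepFun (fun ω => x i ω j * x k ω j) (fun ω => e ω i * e ω k) P :=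
    fun i k j => hind.comp (φ := fun X : Fin N → Fin D → ℝ => X i j * X k j)
      (ψ := fun v : Fin N → ℝ => v i * v k) (by fun_prop) (by fun_prop)
  have hint : ∀ i k j, Integrable (fun ω => (x i ω j * x k ω j) * (e ω i * e ω k)) P :=
    fun i k j => (hindep i k j).integrable_mul (hxx i k j) (hee i k).1
  have hexp : ∀ ω, ∑ j, (∑ i, x i ω j * e ω i) ^ 2 =
      ∑ j, ∑ i, ∑ k, (x i ω j * x k ω j) * (e ω i * e ω k) := by
    intro ω
    refine Finset.sum_congr rfl fun j _ => ?_
    rw [sq, Finset.sum_mul_sum]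
    exact Finset.sum_congr rfl fun i _ => Finset.sum_congr rfl fun k _ => by ring
  simp only [hexp]
  refine ⟨integrable_finsetSum _ fun j _ => integrable_finsetSum _ fun i _ =>
    integrable_finsetSum _ fun k _ => hint i k j, ?_⟩
  rw [integral_finsetSum _ fun j _ => integrable_finsetSum _ fun i _ =>
    integrable_finsetSum _ fun k _ => hint i k j]
  have hcol : ∀ j, ∫ ω, ∑ i, ∑ k, (x i ω j * x k ω j) * (e ω i * e ω k) ∂P ≤
      N * (6 * L ^ 2 * σ ^ 2) := by
    intro j
    rw [integral_finsetSum _ fun i _ => integrable_finsetSum _ fun k _ => hint i k j]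
    have hrow : ∀ i, ∫ ω, ∑ k, (x i ω j * x k ω j) * (e ω i * e ω k) ∂P ≤
        6 * L ^ 2 * σ ^ 2 := by
      intro i
      rw [integral_finsetSum _ fun k _ => hint i k j]
      -- The noise is centred with independent coordinates and independent of the design, so only
      -- the diagonal k = i survives; independence of the rows plays no role here.
      have : ∀ k, ∫ ω, (x i ω j * x k ω j) * (e ω i * e ω k) ∂P =
          if i = k then (∫ ω, x i ω j * x k ω j ∂P) * (σ : ℝ) ^ 2 else 0 := by
        intro k
        rw [(hindep i k j).integral_fun_mul_eq_mul_integral (hxx i k j).aestronglyMeasurable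
          (hee i k).1.aestronglyMeasurable, (hee i k).2]
        split_ifs <;> simp
      simp only [this, Finset.sum_ite_eq, Finset.mem_univ, if_true]
      have h2 := (integrable_sq (P := P) (f := fun ω => x i ω j) (by have := hx i; fun_prop) hL
        ((hsub i).coord j)).2
      simp only [sq (x i _ j)] at h2
      gcongr
    calc _ ≤ ∑ _i : Fin N, 6 * L ^ 2 * (σ : ℝ) ^ 2 := Finset.sum_le_sum fun i _ => hrow i
      _ = _ := by simp
  calc _ ≤ ∑ _j : Fin D, N * (6 * L ^ 2 * (σ : ℝ) ^ 2) := Finset.sum_le_sum fun j _ => hcol j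
    _ = _ := by simp [mul_assoc]

/-- Markov's inequality, conditionally on an independent variable. -/
theorem measure_le_of_indepFun {Ω A B : Type*} [MeasurableSpace Ω] [MeasurableSpace A]
    [MeasurableSpace B] {P : Measure Ω} [IsProbabilityMeasure P] {δ : Ω → A} {W : Ω → B}
    (hδ : Measurable δ) (hW : Measurable W) (hind : IndepFun δ W P)
    {F : A × B → ENNReal} (hF : Measurable F) {c t : ENNReal} (hc : c ≠ 0) (hc' : c ≠ ⊤) :
    P {ω | c ≤ F (δ ω, W ω)} ≤ P {ω | t < ∫⁻ a, F (a, W ω) ∂(P.map δ)} + t / c := by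
  have := Measure.isProbabilityMeasure_map (μ := P) hδ.aemeasurable
  have := Measure.isProbabilityMeasure_map (μ := P) hW.aemeasurable
  have hG : Measurable fun w => ∫⁻ a, F (a, w) ∂(P.map δ) := hF.lintegral_prod_left'
  have hprod := (indepFun_iff_map_prod_eq_prod_map_map hδ.aemeasurable hW.aemeasurable).1 hind
  have hS : MeasurableSet {p | c ≤ F p} := measurableSet_le measurable_const hF
  have hT : MeasurableSet {w | t < ∫⁻ a, F (a, w) ∂(P.map δ)} :=
    measurableSet_lt measurable_const hG
  calc P {ω | c ≤ F (δ ω, W ω)} = P.map (fun ω => (δ ω, W ω)) {p | c ≤ F p} := by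
        rw [Measure.map_apply (hδ.prodMk hW) hS]
        rfl
    _ = ∫⁻ w, P.map δ {a | c ≤ F (a, w)} ∂(P.map W) := by
        rw [hprod, Measure.prod_apply_symm hS]
        rfl
    -- For fixed w, either the conditional mean exceeds t and the probability is bounded by 1, or
    -- Markov's inequality gives t/c.
    _ ≤ ∫⁻ w, ({w | t < ∫⁻ a, F (a, w) ∂(P.map δ)}.indicator 1 w + t / c) ∂(P.map W) := by
        refine lintegral_mono fun w => ?_
        by_cases hw : t < ∫⁻ a, F (a, w) ∂(P.map δ)
        · rw [Set.indicator_of_mem (by exact hw)]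
          exact prob_le_one.trans le_self_add
        · rw [Set.indicator_of_notMem (by exact hw), zero_add]
          exact (meas_ge_le_lintegral_div (by fun_prop) hc hc').trans
            (ENNReal.div_le_div_right (not_lt.1 hw) c)
    _ = _ := by
        rw [lintegral_add_right _ measurable_const, lintegral_indicator_one hT,
          Measure.map_apply hW hT]
        simp

/-- An estimate that is close to `b` in Euclidean norm identifies the support of `b`. -/
theorem IsTopSet.eq_supp {D : ℕ} {b c : Fin D → ℝ} {η : ℝ} (hη : 0 < η)
    (hb : ∀ j ∈ supp b, η < |b j|) (hc : ∑ j, (c j - b j) ^ 2 < (η / 2) ^ 2)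
    {T : Finset (Fin D)} (hT : IsTopSet c (supp b).card T) : T = supp b := by
  have hj : ∀ j, |c j - b j| < η / 2 := fun j =>
    abs_lt_of_sq_lt_sq ((Finset.single_le_sum (f := fun j => (c j - b j) ^ 2)
      (fun _ _ => sq_nonneg _) (Finset.mem_univ j)).trans_lt hc) (by positivity)
  by_contra hne
  -- Equal cardinalities make both differences nonempty. An index of T outside the support has |c| <
  -- η/2, yet must dominate a missed support index, where |c| > η/2.
  have h1 : ¬ T ⊆ supp b := fun h => hne (Finset.eq_of_subset_of_card_le h hT.1.ge)
  have h2 : ¬ supp b ⊆ T := fun h => hne (Finset.eq_of_subset_of_card_le h hT.1.le).symm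
  obtain ⟨i, hiT, hi⟩ := Finset.not_subset.1 h1
  obtain ⟨k, hk, hkT⟩ := Finset.not_subset.1 h2
  have h3 := hT.2 i hiT k hkT
  have hbi : b i = 0 := by simpa [supp] using hi
  have h4 := hj i
  rw [hbi, sub_zero] at h4
  have h5 := hb k hk
  have h6 := hj k
  have h7 := abs_sub_abs_le_abs_sub (b k) (c k)
  rw [abs_sub_comm] at h7
  linarith

end
section

variable {N D : ℕ}

/-! ### Gates, risk comparison and the deterministic error bound -/

theorem gate_mem_Icc (m d : ℝ) : gate m d ∈ Set.Icc (0 : ℝ) 1 :=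
  ⟨le_max_left _ _, max_le zero_le_one (min_le_left _ _)⟩

theorem gates_mem_Icc (m d : Fin D → ℝ) : gates m d ∈ Set.Icc (0 : Fin D → ℝ) 1 :=
  ⟨fun _ => (gate_mem_Icc _ _).1, fun _ => (gate_mem_Icc _ _).2⟩

theorem continuous_gates (m : Fin D → ℝ) : Continuous (gates m) := by
  unfold gates gate
  fun_prop

/-- Gate values lie in a compact cube, so the bound is uniform in both m and the noise; it supplies
the dominating constant when the gates are opened. -/
theorem exists_bound_comp_gates {F : (Fin D → ℝ) → ℝ} (hF : Continuous F) :
    ∃ C, ∀ m d, ‖F (gates m d)‖ ≤ C := by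
  obtain ⟨C, hC⟩ := (isCompact_Icc (a := (0 : Fin D → ℝ)) (b := 1)).exists_bound_of_continuousOn
    hF.continuousOn
  exact ⟨C, fun m d => hC _ (gates_mem_Icc m d)⟩

theorem integrable_comp_gates {F : (Fin D → ℝ) → ℝ} (hF : Continuous F) (m : Fin D → ℝ)
    (s : ℝ≥0) : Integrable (fun d => F (gates m d)) (gaussianVec D s) := by
  obtain ⟨C, hC⟩ := exists_bound_comp_gates hF
  exact Integrable.mono' (integrable_const C)
    (hF.comp (continuous_gates m)).aestronglyMeasurable (ae_of_all _ fun d => hC m d)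

theorem continuous_residual (X : Matrix (Fin N) (Fin D) ℝ) (y : Fin N → ℝ) (θ : Fin D → ℝ) :
    Continuous fun z : Fin D → ℝ => ‖WithLp.toLp 2 (y - X.mulVec (θ * z))‖ ^ 2 := by
  have : Continuous fun z : Fin D → ℝ => y - X.mulVec (θ * z) :=
    continuous_const.sub (Continuous.matrix_mulVec continuous_const (continuous_const.mul continuous_id))
  exact (((PiLp.continuous_toLp 2 _).comp this).norm).pow 2

theorem stdNormalCdf_nonneg (t : ℝ) : 0 ≤ stdNormalCdf t := cdf_nonneg _ _

/-- Opening all gates in the support of `θ` and closing all others sends the risk of `θ` to its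
squared loss plus the size of the support times the regularization parameter. -/
theorem tendsto_risk_open_gates (X : Matrix (Fin N) (Fin D) ℝ) (y : Fin N → ℝ) (lam : ℝ)
    {τ : ℝ≥0} (hτ : 0 < τ) (θ : Fin D → ℝ) :
    Tendsto (fun M : ℝ => risk X y lam τ θ fun j => if θ j ≠ 0 then M else -M) atTop
      (𝓝 (‖WithLp.toLp 2 (y - X.mulVec θ)‖ ^ 2 / N + lam * (supp θ).card)) := by
  have hτ' : (0 : ℝ) < τ := hτ
  unfold risk
  refine Tendsto.add (Tendsto.div_const ?_ _) (Tendsto.const_mul _ ?_)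
  · obtain ⟨C, hC⟩ := exists_bound_comp_gates (continuous_residual X y θ)
    have hlim : ∀ d : Fin D → ℝ, Tendsto (fun M : ℝ => ‖WithLp.toLp 2 (y - X.mulVec (θ *
        gates (fun j => if θ j ≠ 0 then M else -M) d))‖ ^ 2) atTop
        (𝓝 (‖WithLp.toLp 2 (y - X.mulVec θ)‖ ^ 2)) := by
      intro d
      refine tendsto_const_nhds.congr' ?_
      -- For each noise vector the gates on the support are eventually exactly 1. The others
      -- multiply zero entries of θ, so closing them affects only the penalty.
      have hev : ∀ᶠ M : ℝ in atTop, ∀ j, 1 ≤ M + d j :=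
        eventually_all.2 fun j => (eventually_ge_atTop (1 - d j)).mono fun M hM => by linarith
      filter_upwards [hev] with M hM
      have : θ * gates (fun j => if θ j ≠ 0 then M else -M) d = θ := by
        funext j
        by_cases h : θ j = 0
        · simp [h]
        · simp [gates, gate, h, min_eq_left (hM j)]
      rw [this]
    have := tendsto_integral_filter_of_dominated_convergence (μ := gaussianVec D τ) (l := atTop)
      (fun _ => C)
      (Eventually.of_forall fun M : ℝ => (((continuous_residual X y θ).comp
        (continuous_gates fun j => if θ j ≠ 0 then M else -M)).aestronglyMeasurable))
      (Eventually.of_forall fun M => ae_of_all _ fun d => hC _ d)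
      (integrable_const C) (ae_of_all _ hlim)
    simpa using this
  · have hcard : ((supp θ).card : ℝ) = ∑ j, if θ j ≠ 0 then (1 : ℝ) else 0 := by
      rw [Finset.sum_boole, supp]
    rw [hcard]
    refine tendsto_finsetSum _ fun j _ => ?_
    dsimp only
    split_ifs with h
    · exact (tendsto_cdf_atTop _).comp (tendsto_id.atTop_div_const hτ')
    · exact (tendsto_cdf_atBot _).comp (tendsto_neg_atTop_atBot.atBot_div_const hτ')

/-- Finite m keeps Φ strictly between 0 and 1, so the comparison value is only a limit of risks;
near-minimality survives the limit. The estimator's own penalty is nonnegative and is dropped. -/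
theorem IsNearMinimizer.integral_residual_le {X : Matrix (Fin N) (Fin D) ℝ} {y : Fin N → ℝ}
    {lam : ℝ} (hlam : 0 ≤ lam) {τ : ℝ≥0} (hτ : 0 < τ) {r : ℝ} {θ m : Fin D → ℝ}
    (h : IsNearMinimizer X y lam τ r θ m) (β : Fin D → ℝ) :
    (∫ d, ‖WithLp.toLp 2 (y - X.mulVec (θ * gates m d))‖ ^ 2 ∂(gaussianVec D τ)) / N ≤
      ‖WithLp.toLp 2 (y - X.mulVec β)‖ ^ 2 / N + (supp β).card * lam + r := by
  have h1 : risk X y lam τ θ m ≤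
      ‖WithLp.toLp 2 (y - X.mulVec β)‖ ^ 2 / N + lam * (supp β).card + r :=
    ge_of_tendsto ((tendsto_risk_open_gates X y lam hτ β).add_const r)
      (Eventually.of_forall fun M => h _ _)
  have h2 : 0 ≤ lam * ∑ j, stdNormalCdf (m j / τ) :=
    mul_nonneg hlam (Finset.sum_nonneg fun j _ => stdNormalCdf_nonneg _)
  unfold risk at h1
  linarith

/-- Deterministic estimation error bound for near-minimizers of the STG risk. -/
theorem IsNearMinimizer.integral_error_le {X : Matrix (Fin N) (Fin D) ℝ} {y e : Fin N → ℝ}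
    {β : Fin D → ℝ} (hy : y = X.mulVec β + e) (hN : 0 < N)
    {lam : ℝ} (hlam : 0 ≤ lam) {τ : ℝ≥0} (hτ : 0 < τ) {r : ℝ} {θ m : Fin D → ℝ}
    (h : IsNearMinimizer X y lam τ r θ m) {κ : ℝ} (hκ : 0 < κ)
    (hX : ∀ u : Fin D → ℝ, N * κ * ∑ j, u j ^ 2 ≤ ∑ i, (∑ j, X i j * u j) ^ 2) :
    κ / 2 * ∫ d, ∑ j, (θ j * gates m d j - β j) ^ 2 ∂(gaussianVec D τ) ≤
      2 / κ * ((∑ j, (∑ i, X i j * e i) ^ 2) / (N : ℝ) ^ 2) + (supp β).card * lam + r := by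
  have hN' : (0 : ℝ) < N := Nat.cast_pos.2 hN
  set g : Fin D → ℝ := fun j => ∑ i, X i j * e i with hg
  -- With u = θ ⊙ z - β, expand ‖e - Xu‖² and absorb the cross term by Young's inequality into half
  -- of the curvature κN‖u‖². The term ‖e‖² later cancels against the loss at β.
  have hpt : ∀ z : Fin D → ℝ, (∑ i, e i ^ 2 - 2 / (κ * N) * ∑ j, g j ^ 2) +
      κ * N / 2 * ∑ j, (θ j * z j - β j) ^ 2 ≤ ‖WithLp.toLp 2 (y - X.mulVec (θ * z))‖ ^ 2 := by
    intro z
    set u : Fin D → ℝ := fun j => θ j * z j - β j with hu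
    have h1 : ‖WithLp.toLp 2 (y - X.mulVec (θ * z))‖ ^ 2 = ∑ i, (e i - ∑ j, X i j * u j) ^ 2 := by
      rw [EuclideanSpace.real_norm_sq_eq]
      refine Finset.sum_congr rfl fun i _ => ?_
      simp only [hy, Pi.sub_apply, Pi.add_apply, Matrix.mulVec, dotProduct, Pi.mul_apply, hu,
        mul_sub, Finset.sum_sub_distrib]
      ring
    have h2 : ∑ i, (e i - ∑ j, X i j * u j) ^ 2 =
        ∑ i, e i ^ 2 - 2 * ∑ j, g j * u j + ∑ i, (∑ j, X i j * u j) ^ 2 := by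
      have : ∑ j, g j * u j = ∑ i, e i * ∑ j, X i j * u j := by
        simp only [hg, Finset.sum_mul, Finset.mul_sum]
        rw [Finset.sum_comm]
        exact Finset.sum_congr rfl fun i _ => Finset.sum_congr rfl fun j _ => by ring
      rw [this, Finset.mul_sum, ← Finset.sum_sub_distrib, ← Finset.sum_add_distrib]
      exact Finset.sum_congr rfl fun i _ => by ring
    have h3 : 2 * ∑ j, g j * u j ≤ 2 / (κ * N) * ∑ j, g j ^ 2 + κ * N / 2 * ∑ j, u j ^ 2 := by
      rw [Finset.mul_sum, Finset.mul_sum, Finset.mul_sum, ← Finset.sum_add_distrib]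
      refine Finset.sum_le_sum fun j _ => ?_
      have hpos : 0 < κ * N := by positivity
      have h4 : 0 ≤ (2 * g j - κ * N * u j) ^ 2 / (2 * (κ * N)) := by positivity
      have h5 : (2 * g j - κ * N * u j) ^ 2 / (2 * (κ * N)) =
          2 / (κ * N) * g j ^ 2 + κ * N / 2 * u j ^ 2 - 2 * (g j * u j) := by
        field_simp
        ring
      linarith
    have h6 := hX u
    rw [h1, h2]
    linarith
  have hc1 : Continuous fun z : Fin D → ℝ => ∑ j, (θ j * z j - β j) ^ 2 := by fun_prop
  have hi1 := integrable_comp_gates hc1 m τ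
  have hi2 := integrable_comp_gates (continuous_residual X y θ) m τ
  have hmono := integral_mono ((integrable_const _).add (hi1.const_mul (κ * N / 2))) hi2
    fun d => hpt (gates m d)
  simp only [Pi.add_apply] at hmono
  rw [integral_add (integrable_const _) (hi1.const_mul _), integral_const_mul] at hmono
  simp only [integral_const, probReal_univ, smul_eq_mul, one_mul] at hmono
  have hres := h.integral_residual_le hlam hτ β
  have he : ‖WithLp.toLp 2 (y - X.mulVec β)‖ ^ 2 = ∑ i, e i ^ 2 := by
    rw [EuclideanSpace.real_norm_sq_eq, hy]
    simp
  rw [he] at hres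
  have hmono' := div_le_div_of_nonneg_right hmono hN'.le
  have hfinal := hmono'.trans hres
  have e1 : ((∑ i, e i ^ 2 - 2 / (κ * N) * ∑ j, g j ^ 2) + κ * N / 2 *
      ∫ d, ∑ j, (θ j * gates m d j - β j) ^ 2 ∂(gaussianVec D τ)) / N =
      (∑ i, e i ^ 2) / N - 2 / κ * ((∑ j, g j ^ 2) / (N : ℝ) ^ 2) +
        κ / 2 * ∫ d, ∑ j, (θ j * gates m d j - β j) ^ 2 ∂(gaussianVec D τ) := by
    field_simp
  rw [e1] at hfinal
  linarith

end

/-! ### Asymptotics -/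

theorem tendsto_pow_mul_exp_neg {D : ℕ → ℕ} (hD : Tendsto (fun N => (D N : ℝ) / (N : ℝ)) atTop (𝓝 0))
    {M c : ℝ} (hM : 0 < M) (hc : 0 < c) :
    Tendsto (fun N : ℕ => M ^ D N * Real.exp (-c * N)) atTop (𝓝 0) := by
  have hlim : Tendsto (fun N : ℕ => (D N : ℝ) / N * Real.log M) atTop (𝓝 0) := by
    simpa using hD.mul_const (Real.log M)
  have hexp : Tendsto (fun N : ℕ => Real.exp (-(c / 2 * N))) atTop (𝓝 0) :=
    Real.tendsto_exp_neg_atTop_nhds_zero.comp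
      (tendsto_natCast_atTop_atTop.const_mul_atTop (by positivity))
  refine squeeze_zero' (Eventually.of_forall fun N => by positivity) ?_ hexp
  filter_upwards [hlim.eventually_le_const (show (0 : ℝ) < c / 2 by positivity),
    eventually_gt_atTop 0] with N hN hN0
  have hN0' : (0 : ℝ) < N := Nat.cast_pos.2 hN0
  have h1 : M ^ D N = Real.exp (D N * Real.log M) := by
    rw [Real.exp_nat_mul, Real.exp_log hM]
  rw [h1, ← Real.exp_add, Real.exp_le_exp]
  have h2 : (D N : ℝ) * Real.log M ≤ c / 2 * N := by
    calc (D N : ℝ) * Real.log M = ((D N : ℝ) / N * Real.log M) * N := by field_simp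
      _ ≤ _ := by gcongr
  linarith

/-- In the regime `D / N → 0`, the empirical second moment matrices of sub-Gaussian designs are
bounded below with probability tending to one. -/
theorem tendsto_measure_exists_sum_sq_lt {Ω : ℕ → Type*} [∀ N, MeasurableSpace (Ω N)]
    {P : ∀ N, Measure (Ω N)} [∀ N, IsProbabilityMeasure (P N)] {D : ℕ → ℕ}
    {x : ∀ N, Fin N → Ω N → Fin (D N) → ℝ} (hx : ∀ N i, Measurable (x N i))
    (hx_indep : ∀ N, iIndepFun (x N) (P N))
    {L : ℝ} (hL : 0 < L) (hx_sub : ∀ N i, IsSubGaussianVec (P N) L (x N i))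
    {ρ : ℝ} (hρ : 0 < ρ)
    (hlow : ∀ᶠ N in atTop, ∀ i, ∀ u : EuclideanSpace ℝ (Fin (D N)), ‖u‖ = 1 →
      ρ ≤ ∫ ω, (∑ j, x N i ω j * u j) ^ 2 ∂(P N))
    (hD : Tendsto (fun N => (D N : ℝ) / (N : ℝ)) atTop (𝓝 0)) :
    Tendsto (fun N => (P N).real {ω | ∃ u : Fin (D N) → ℝ,
      ∑ i, (∑ j, x N i ω j * u j) ^ 2 < N * (ρ / 8) * ∑ j, u j ^ 2}) atTop (𝓝 0) := by
  have hB : 0 < √(6 * L ^ 2) := by positivity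
  -- The mesh depends only on ρ and L, so the base 1 + 2/ε of the net size does not vary with N.
  set ε : ℝ := min (1 / 2) (√(ρ / 2) / (4 * √(6 * L ^ 2))) with hεdef
  have hε0 : 0 < ε := by positivity
  have hερ : ε * (2 * √(6 * L ^ 2)) ≤ √(ρ / 2) / 2 := by
    calc ε * (2 * √(6 * L ^ 2)) ≤ √(ρ / 2) / (4 * √(6 * L ^ 2)) * (2 * √(6 * L ^ 2)) := by
          gcongr
          exact min_le_right _ _
      _ = _ := by field_simp; norm_num
  have hM : 0 < 1 + 2 / ε := by positivity
  have hlim := (tendsto_pow_mul_exp_neg hD hM (show 0 < ρ ^ 2 / (192 * L ^ 4) by positivity)).add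
    (tendsto_pow_mul_exp_neg hD hM one_pos)
  rw [add_zero] at hlim
  refine squeeze_zero' (Eventually.of_forall fun N => measureReal_nonneg) ?_ hlim
  filter_upwards [hlow] with N hN
  have := measure_exists_sum_sq_lt (hx N) (hx_indep N) hL (hx_sub N) hρ.le hN hε0 (min_le_left _ _)
    hερ
  refine this.trans_eq ?_
  rw [mul_add, neg_one_mul]

theorem le_integral_marginal_sq {Ω : Type*} [MeasurableSpace Ω] {P : Measure Ω}
    [IsProbabilityMeasure P] {D : ℕ} {ξ : Ω → Fin D → ℝ} (hξ : ∀ j, MemLp (fun ω => ξ ω j) 2 P)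
    {m : Fin D → ℝ} {S : Matrix (Fin D) (Fin D) ℝ} (hm : ∀ j, ∫ ω, ξ ω j ∂P = m j)
    (hS : ∀ j k, covariance (fun ω => ξ ω j) (fun ω => ξ ω k) P = S j k) {ρ : ℝ}
    (hρ : ρ ≤ rhoMin (S + Matrix.vecMulVec m m)) {u : EuclideanSpace ℝ (Fin D)} (hu : ‖u‖ = 1) :
    ρ ≤ ∫ ω, (∑ j, ξ ω j * u j) ^ 2 ∂P := by
  -- Symmetry of S is inherited from the covariance.
  have hH : (S + Matrix.vecMulVec m m).IsHermitian := by
    ext j k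
    simp only [Matrix.conjTranspose_apply, Matrix.add_apply, Matrix.vecMulVec_apply, star_trivial]
    rw [← hS, ← hS, covariance_comm, mul_comm]
  have h1 := rhoMin_mul_le hH hρ u
  rw [← EuclideanSpace.real_norm_sq_eq, hu, one_pow, mul_one] at h1
  rwa [integral_marginal_sq hξ hm hS]

theorem measurable_gate_error {D : ℕ} (b : Fin D → ℝ) :
    Measurable fun p : (Fin D → ℝ) × (Fin D → ℝ) × (Fin D → ℝ) =>
      ENNReal.ofReal (∑ j, (p.2.1 j * gates p.2.2 p.1 j - b j) ^ 2) := by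
  unfold gates gate
  fun_prop

/-- For a near-minimizer, the mean squared error conditionally on the data tends to zero in
probability. -/
theorem tendsto_measure_lt_lintegral_gate_error {Ω : ℕ → Type*} [∀ N, MeasurableSpace (Ω N)]
    {P : ∀ N, Measure (Ω N)} [∀ N, IsProbabilityMeasure (P N)]
    {D : ℕ → ℕ} {β : ∀ N, Fin (D N) → ℝ} {lam : ℕ → ℝ} (hlam : ∀ N, 0 ≤ lam N)
    {σ τ : ℝ≥0} (hτ : 0 < τ)
    {x : ∀ N, Fin N → Ω N → Fin (D N) → ℝ} (hx : ∀ N i, Measurable (x N i))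
    {L : ℝ} (hL : 0 < L) (hx_sub : ∀ N i, IsSubGaussianVec (P N) L (x N i))
    {κ : ℝ} (hκ : 0 < κ)
    (hRE : Tendsto (fun N => (P N).real {ω | ∃ u : Fin (D N) → ℝ,
      ∑ i, (∑ j, x N i ω j * u j) ^ 2 < N * κ * ∑ j, u j ^ 2}) atTop (𝓝 0))
    {e : ∀ N, Ω N → Fin N → ℝ} (he : ∀ N, Measurable (e N))
    (he_law : ∀ N, (P N).map (e N) = gaussianVec N σ)
    (he_indep : ∀ N, IndepFun (fun ω i => x N i ω) (e N) (P N))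
    {y : ∀ N, Ω N → Fin N → ℝ}
    (hy : ∀ N ω, y N ω = (Matrix.of fun i => x N i ω).mulVec (β N) + e N ω)
    {r : ℕ → ℝ} (hr : Tendsto r atTop (𝓝 0))
    {θhat mhat : ∀ N, Ω N → Fin (D N) → ℝ}
    (hmin : ∀ N, ∀ᵐ ω ∂(P N), IsNearMinimizer (Matrix.of fun i => x N i ω) (y N ω)
      (lam N) τ (r N) (θhat N ω) (mhat N ω))
    (hD : Tendsto (fun N => (D N : ℝ) / (N : ℝ)) atTop (𝓝 0))
    (hKlam : Tendsto (fun N => ((supp (β N)).card : ℝ) * lam N) atTop (𝓝 0))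
    {t : ℝ} (ht : 0 < t) :
    Tendsto (fun N => (P N).real {ω | ENNReal.ofReal t < ∫⁻ d, ENNReal.ofReal
      (∑ j, (θhat N ω j * gates (mhat N ω) d j - β N j) ^ 2) ∂(gaussianVec (D N) τ)})
      atTop (𝓝 0) := by
  -- Chosen so that the noise term 2c/κ equals κt/4. Penalty and optimization error get another
  -- κt/4, and the sum κt/2 matches the factor κ/2 on the left.
  set c : ℝ := κ ^ 2 * t / 8 with hc
  have hc0 : 0 < c := by positivity
  have hbound : Tendsto (fun N => (P N).real {ω | ∃ u : Fin (D N) → ℝ,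
      ∑ i, (∑ j, x N i ω j * u j) ^ 2 < N * κ * ∑ j, u j ^ 2} +
      (D N : ℝ) / N * (6 * L ^ 2 * σ ^ 2 / c)) atTop (𝓝 0) := by
    simpa using hRE.add (hD.mul_const (6 * L ^ 2 * (σ : ℝ) ^ 2 / c))
  refine squeeze_zero' (Eventually.of_forall fun N => measureReal_nonneg) ?_ hbound
  have hsmall := (hKlam.add hr).eventually_le_const (show (0 : ℝ) + 0 < κ * t / 4 by
    rw [add_zero]; positivity)
  filter_upwards [hsmall, eventually_gt_atTop 0] with N hN hN0
  have hN0' : (0 : ℝ) < N := Nat.cast_pos.2 hN0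
  set G : Ω N → ℝ := fun ω => ∑ j, (∑ i, x N i ω j * e N ω i) ^ 2 with hG
  obtain ⟨hGi, hGle⟩ := integral_sum_sq_design_noise_le hL (hx N) (hx_sub N) (he N) (he_law N)
    (he_indep N)
  have hmarkov : (P N).real {ω | c * N ^ 2 ≤ G ω} ≤ (D N : ℝ) / N * (6 * L ^ 2 * σ ^ 2 / c) := by
    have h1 := mul_meas_ge_le_integral_of_nonneg (μ := P N) (f := G)
      (ae_of_all _ fun ω => Finset.sum_nonneg fun j _ => sq_nonneg _) hGi (c * N ^ 2)
    have h2 : (P N).real {ω | c * N ^ 2 ≤ G ω} ≤ (D N : ℝ) * N * (6 * L ^ 2 * σ ^ 2) / (c * N ^ 2) := by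
      rw [le_div_iff₀ (by positivity), mul_comm]
      exact h1.trans hGle
    refine h2.trans_eq ?_
    field_simp
  refine le_trans ?_ ((measureReal_union_le _ _).trans (add_le_add_right hmarkov _))
  refine ENNReal.toReal_mono (measure_ne_top _ _) (measure_mono_ae ?_)
  filter_upwards [hmin N] with ω hω hlt
  by_contra hcon
  have hcon' : ¬ ((∃ u : Fin (D N) → ℝ,
      ∑ i, (∑ j, x N i ω j * u j) ^ 2 < N * κ * ∑ j, u j ^ 2) ∨ c * N ^ 2 ≤ G ω) := hcon
  push Not at hcon'
  obtain ⟨hlow, hGω⟩ := hcon'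
  have hdet := hω.integral_error_le (hy N ω) hN0 (hlam N) hτ hκ hlow
  have hGdiv : (∑ j, (∑ i, (Matrix.of fun i => x N i ω) i j * e N ω i) ^ 2) / (N : ℝ) ^ 2 ≤ c := by
    rw [div_le_iff₀ (by positivity)]
    exact hGω.le
  have hmul : 2 / κ * ((∑ j, (∑ i, (Matrix.of fun i => x N i ω) i j * e N ω i) ^ 2) / (N : ℝ) ^ 2) ≤
      κ * t / 4 := by
    calc _ ≤ 2 / κ * c := by gcongr
      _ = κ * t / 4 := by rw [hc]; field_simp; norm_num
  have hle : ∫ d, ∑ j, (θhat N ω j * gates (mhat N ω) d j - β N j) ^ 2 ∂(gaussianVec (D N) τ) ≤ t := by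
    have : κ / 2 * ∫ d, ∑ j, (θhat N ω j * gates (mhat N ω) d j - β N j) ^ 2
        ∂(gaussianVec (D N) τ) ≤ κ / 2 * t := by linarith
    exact le_of_mul_le_mul_left this (by positivity)
  have hcont : Continuous fun z : Fin (D N) → ℝ => ∑ j, (θhat N ω j * z j - β N j) ^ 2 := by
    fun_prop
  have hlt' : ENNReal.ofReal t < ∫⁻ d, ENNReal.ofReal
      (∑ j, (θhat N ω j * gates (mhat N ω) d j - β N j) ^ 2) ∂(gaussianVec (D N) τ) := hlt
  rw [← ofReal_integral_eq_lintegral_ofReal (integrable_comp_gates hcont (mhat N ω) τ)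
    (ae_of_all _ fun d => Finset.sum_nonneg fun j _ => sq_nonneg _)] at hlt'
  exact absurd hlt' (not_lt.2 (ENNReal.ofReal_le_ofReal hle))

/-- Only subadditivity is used, so the events need not be measurable. -/
theorem tendsto_measure_one_of_compl {Ω : ℕ → Type*} [∀ N, MeasurableSpace (Ω N)]
    {P : ∀ N, Measure (Ω N)} [∀ N, IsProbabilityMeasure (P N)] {A : ∀ N, Set (Ω N)}
    (h : Tendsto (fun N => P N (A N)ᶜ) atTop (𝓝 0)) : Tendsto (fun N => P N (A N)) atTop (𝓝 1) := by
  have h1 : Tendsto (fun N => 1 - P N (A N)ᶜ) atTop (𝓝 1) := by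
    simpa using ENNReal.Tendsto.sub tendsto_const_nhds h (Or.inl ENNReal.one_ne_top)
  refine tendsto_of_tendsto_of_tendsto_of_le_of_le h1 tendsto_const_nhds (fun N => ?_)
    fun N => prob_le_one
  refine tsub_le_iff_right.2 ?_
  rw [← measure_univ (μ := P N), ← Set.union_compl_self (A N)]
  exact measure_union_le _ _

end STG

/-! ### Support recovery -/

theorem mainTheorem5
    {Ω : ℕ → Type*} [∀ N, MeasurableSpace (Ω N)]
    (P : ∀ N, Measure (Ω N)) [∀ N, IsProbabilityMeasure (P N)]
    -- dimensions, sparsity, true coefficients, regularization, noise levels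
    (D K : ℕ → ℕ) (β : ∀ N, Fin (D N) → ℝ) (lam : ℕ → ℝ) (hlam : ∀ N, 0 ≤ lam N)
    (σ τ : ℝ≥0) (hτ : 0 < τ)
    (hK : ∀ N, (STG.supp (β N)).card = K N)
    (η : ℝ) (hη : 0 < η) (hβ : ∀ N, ∀ j ∈ STG.supp (β N), η < |β N j|)
    -- independent sub-Gaussian design vectors with mean `μ` and covariance matrix `S`
    (x : ∀ N, Fin N → Ω N → Fin (D N) → ℝ)
    (hx : ∀ N i, Measurable (x N i))
    (hx_indep : ∀ N, iIndepFun (x N) (P N))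
    (L : ℝ) (hL : 0 < L) (hx_sub : ∀ N i, STG.IsSubGaussianVec (P N) L (x N i))
    (μ : ∀ N, Fin (D N) → ℝ) (S : ∀ N, Matrix (Fin (D N)) (Fin (D N)) ℝ)
    (hμ : ∀ N i j, ∫ ω, x N i ω j ∂(P N) = μ N j)
    (hS : ∀ N i j k, covariance (fun ω => x N i ω j) (fun ω => x N i ω k) (P N) = S N j k)
    (ρ : ℝ) (hρ : 0 < ρ)
    (hρ_min : ∀ᶠ N in atTop, ρ ≤ STG.rhoMin (S N + Matrix.vecMulVec (μ N) (μ N)))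
    -- Gaussian observation noise, independent of the design
    (e : ∀ N, Ω N → Fin N → ℝ) (he : ∀ N, Measurable (e N))
    (he_law : ∀ N, (P N).map (e N) = STG.gaussianVec N σ)
    (he_indep : ∀ N, IndepFun (fun ω i => x N i ω) (e N) (P N))
    -- responses of the linear model
    (y : ∀ N, Ω N → Fin N → ℝ)
    (hy : ∀ N ω, y N ω = (Matrix.of fun i => x N i ω).mulVec (β N) + e N ω)
    -- (near-)minimizers of the risk
    (r : ℕ → ℝ) (hr_nonneg : ∀ N, 0 ≤ r N) (hr : Tendsto r atTop (𝓝 0))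
    (θhat mhat : ∀ N, Ω N → Fin (D N) → ℝ)
    (hθ : ∀ N, Measurable (θhat N)) (hm : ∀ N, Measurable (mhat N))
    (hmin : ∀ N, ∀ᵐ ω ∂(P N), STG.IsNearMinimizer (Matrix.of fun i => x N i ω) (y N ω)
      (lam N) τ (r N) (θhat N ω) (mhat N ω))
    -- Gaussian noise of the gates in the final estimator
    (δ : ∀ N, Ω N → Fin (D N) → ℝ) (hδ : ∀ N, Measurable (δ N))
    (hδ_law : ∀ N, (P N).map (δ N) = STG.gaussianVec (D N) τ)
    (hδ_indep : ∀ N, IndepFun (δ N)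
      (fun ω => ((fun i => x N i ω), e N ω, θhat N ω, mhat N ω)) (P N))
    -- asymptotic regime
    (hD : Tendsto (fun N => (D N : ℝ) / (N : ℝ)) atTop (𝓝 0))
    (hKlam : Tendsto (fun N => (K N : ℝ) * lam N) atTop (𝓝 0)) :
    Tendsto (fun N => P N {ω | ∀ T : Finset (Fin (D N)),
        STG.IsTopSet (θhat N ω * STG.gates (mhat N ω) (δ N ω)) (K N) T →
          T = STG.supp (β N)})
      atTop (𝓝 1) := by
  have hlow : ∀ᶠ N in atTop, ∀ i, ∀ u : EuclideanSpace ℝ (Fin (D N)), ‖u‖ = 1 →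
      ρ ≤ ∫ ω, (∑ j, x N i ω j * u j) ^ 2 ∂(P N) := by
    filter_upwards [hρ_min] with N hN i u hu
    exact STG.le_integral_marginal_sq (fun j => (hx_sub N i).memLp hL (hx N i) j) (hμ N i) (hS N i)
      hN hu
  have hRE := STG.tendsto_measure_exists_sum_sq_lt hx hx_indep hL hx_sub hρ hlow hD
  have herr : ∀ t : ℝ, 0 < t → Tendsto (fun N => (P N).real {ω | ENNReal.ofReal t <
      ∫⁻ d, ENNReal.ofReal (∑ j, (θhat N ω j * STG.gates (mhat N ω) d j - β N j) ^ 2)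
        ∂(STG.gaussianVec (D N) τ)}) atTop (𝓝 0) := fun t ht =>
    STG.tendsto_measure_lt_lintegral_gate_error hlam hτ hx hL hx_sub (by positivity) hRE he he_law
      he_indep hy hr hmin hD (by simpa only [hK] using hKlam) ht
  set c : ℝ := (η / 2) ^ 2 with hc
  have hc0 : 0 < c := by positivity
  -- The level t of the conditional mean error stays free: N → ∞ is taken at fixed t, where t/c is
  -- the remaining Markov term.
  have hfail : ∀ N, ∀ t : ℝ, 0 ≤ t → (P N).real {ω | ∀ T : Finset (Fin (D N)),
      STG.IsTopSet (θhat N ω * STG.gates (mhat N ω) (δ N ω)) (K N) T → T = STG.supp (β N)}ᶜ ≤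
      (P N).real {ω | ENNReal.ofReal t <
        ∫⁻ d, ENNReal.ofReal (∑ j, (θhat N ω j * STG.gates (mhat N ω) d j - β N j) ^ 2)
          ∂(STG.gaussianVec (D N) τ)} + t / c := by
    intro N t ht
    have hind : IndepFun (δ N) (fun ω => (θhat N ω, mhat N ω)) (P N) :=
      (hδ_indep N).comp (φ := id)
        (ψ := fun p : (Fin N → Fin (D N) → ℝ) × (Fin N → ℝ) × (Fin (D N) → ℝ) × (Fin (D N) → ℝ) =>
          p.2.2) measurable_id (by fun_prop)
    have hmk := STG.measure_le_of_indepFun (hδ N) ((hθ N).prodMk (hm N)) hind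
      (STG.measurable_gate_error (β N)) (c := ENNReal.ofReal c) (t := ENNReal.ofReal t)
      (by simpa using hc0) ENNReal.ofReal_ne_top
    rw [hδ_law N, ← ENNReal.ofReal_div_of_pos hc0] at hmk
    have hsub : {ω | ∀ T : Finset (Fin (D N)),
        STG.IsTopSet (θhat N ω * STG.gates (mhat N ω) (δ N ω)) (K N) T → T = STG.supp (β N)}ᶜ ⊆
        {ω | ENNReal.ofReal c ≤ ENNReal.ofReal
          (∑ j, (θhat N ω j * STG.gates (mhat N ω) (δ N ω) j - β N j) ^ 2)} := by
      intro ω hω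
      by_contra hlt
      refine hω fun T hT => ?_
      rw [← hK N] at hT
      refine hT.eq_supp hη (hβ N) ?_
      have hlt' : ¬ ENNReal.ofReal c ≤ ENNReal.ofReal
          (∑ j, (θhat N ω j * STG.gates (mhat N ω) (δ N ω) j - β N j) ^ 2) := hlt
      rw [not_le, ENNReal.ofReal_lt_ofReal_iff hc0] at hlt'
      exact hlt'
    have hle := ENNReal.toReal_mono (by simp) ((measure_mono hsub).trans hmk)
    rwa [ENNReal.toReal_add (measure_ne_top _ _) ENNReal.ofReal_ne_top,
      ENNReal.toReal_ofReal (by positivity)] at hle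
  refine STG.tendsto_measure_one_of_compl ?_
  rw [← ENNReal.tendsto_toReal_iff (fun N => measure_ne_top _ _) ENNReal.zero_ne_top]
  refine (tendsto_order.2 ⟨fun a ha => Eventually.of_forall fun N =>
    lt_of_lt_of_le ha ENNReal.toReal_nonneg, fun a ha => ?_⟩)
  have ha' : 0 < a := ha
  -- With t = c·a/2 the Markov term is a/2, leaving a/2 for the probability that vanishes.
  have ht : 0 < c * (a / 2) := by positivity
  filter_upwards [(herr _ ht).eventually_lt_const (half_pos ha')] with N hN
  refine (hfail N _ ht.le).trans_lt ?_
  rw [mul_div_cancel_left₀ _ hc0.ne']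
  linarith
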